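/- Let $\mathcal H=\mathbb C^d$ be a finite-dimensional Hilbert space, let $\mathcal N$ be a non-empty set of states (positive semidefinite operators of trace one) on $\mathcal H$, and let $\sigma$ be a positive semidefinite operator on $\mathcal H$ with $\operatorname{supp}\rho\subseteq\operatorname{supp}\sigma$ for every $\rho\in\mathcal N$. Powers of a positive semidefinite operator are taken on its support only (so $A^0$ is the projection onto $\operatorname{supp}A$), $\log 0:=-\infty$, $\|X\|_1:=\operatorname{Tr}|X|$ is the trace norm, and $\{X>0\}$ is the spectral projection of a self-adjoint operator $X$ corresponding to $(0,\infty)$. For $t>0$ put $$Q_t^{\mathrm{new}}(\rho\|\sigma):=\operatorname{Tr}\bigl(\sigma^{\frac{1-t}{2t}}\rho\,\sigma^{\frac{1-t}{2t}}\bigr)^t,\qquad \psi(t):=\sup_{\rho\in\mathcal N}\log Q_t^{\mathrm{new}}(\rho\|\sigma),$$ and for $a\in\mathbb R$ put $$\varphi(a):=\sup_{0<t\le 1}\{at-\psi(t)\},\qquad \hat\varphi(a):=\sup_{0<t\le 1}\{a(t-1)-\psi(t)\}.$$ For $n\ge 1$ and a test $T$ on $\mathcal H^{\otimes n}$ let $\alpha_n(T):=\sup_{\rho\in\mathcal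 N}\operatorname{Tr}\rho^{\otimes n}(I-T)$ and $\beta_n(T):=\operatorname{Tr}\sigma^{\otimes n}T$ be the type I and type II errors. For every $n\ge1$ let $\mathcal N(n)\subseteq\mathcal N$ be a finite subset, and put $$\delta(\mathcal N(n)):=\sup_{\rho\in\mathcal N}\inf_{\rho'\in\mathcal N(n)}\|\rho-\rho'\|_1\quad(\inf\emptyset:=+\infty),\qquad S_{n,a}:=\Bigl\{e^{-na}\sum_{\rho\in\mathcal N(n)}\rho^{\otimes n}-\sigma^{\otimes n}>0\Bigr\}.$$ (1) For every $n\ge1$ and every $a\in\mathbb R$, $$\alpha_n(S_{n,a})\le|\mathcal N(n)|\,e^{-n\hat\varphi(a)}+n\,\delta(\mathcal N(n)),\qquad \beta_n(S_{n,a})\le|\mathcal N(n)|\,e^{-n\varphi(a)}.$$ (2) Let $V$ be a real linear space of operators on $\mathcal H$ that contains $\mathcal N$ (for instance the space of all self-adjoint operators, of real dimension $(\dim\mathcal H)^2$), and let $D$ be its real dimension. Let $\kappa>0$ and $\delta_n:=e^{-n\kappa}$, and suppose that for every $n\ge1$ the finite set $\mathcal N(n)\subseteq\mathcal N$ satisfies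 $|\mathcal N(n)|\le(1+2/\delta_n)^{D}$ and that every $\rho\in\mathcal N$ has some $\rho'\in\mathcal N(n)$ with $\|\rho-\rho'\|_1<\delta_n$. Then for every $a\in\mathbb R$, $$\limsup_{n\to\infty}\frac1n\log\alpha_n(S_{n,a})\le-\min\{\kappa,\hat\varphi(a)-\kappa D\},\qquad \limsup_{n\to\infty}\frac1n\log\beta_n(S_{n,a})\le-(\varphi(a)-\kappa D).$$ -/

import Mathlib

open Filter
open scoped ENNReal ComplexOrder

namespace CompositeStein

noncomputable section

variable {d : Type*} [Fintype d] [DecidableEq d]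

/-- Density operators (states) on `ℂ^d`: positive semidefinite with trace one. -/
def IsState (ρ : Matrix d d ℂ) : Prop :=
  ρ.PosSemidef ∧ ρ.trace = 1

/-- The support of a positive semidefinite operator, that is, its range
(the orthogonal complement of its kernel). -/
def supp (A : Matrix d d ℂ) : Submodule ℂ (d → ℂ) :=
  LinearMap.range A.mulVecLin

/-- Real powers of a positive semidefinite operator, taken on its support only: eigenvalue `0`
is sent to `0` for every exponent, so `psdPow A 0` is the projection onto the support of `A`. -/
def psdPow (A : Matrix d d ℂ) (p : ℝ) : Matrix d d ℂ :=
  cfc (fun x : ℝ => if 0 < x then x ^ p else 0) A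

/-- The spectral projection `{X > 0}` of a self-adjoint operator `X`. -/
def posProj (X : Matrix d d ℂ) : Matrix d d ℂ :=
  cfc (fun x : ℝ => if 0 < x then (1 : ℝ) else 0) X

/-- The trace norm `‖X‖₁ = Tr |X|`, with `|X| = (X* X)^{1/2}`. -/
def traceNorm (X : Matrix d d ℂ) : ℝ :=
  (psdPow (X.conjTranspose * X) (1 / 2)).trace.re

/-- The operator `ρ^{⊗ n}` on `(ℂ^d)^{⊗ n}`, in the product basis indexed by `Fin n → d`. -/
def tensorPow (n : ℕ) (ρ : Matrix d d ℂ) : Matrix (Fin n → d) (Fin n → d) ℂ :=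
  Matrix.of fun f g => ∏ i, ρ (f i) (g i)

/-- `Q_t^new(ρ‖σ) = Tr (σ^{(1-t)/(2t)} ρ σ^{(1-t)/(2t)})^t`. -/
def Qnew (t : ℝ) (ρ σ : Matrix d d ℂ) : ℝ :=
  (psdPow (psdPow σ ((1 - t) / (2 * t)) * ρ * psdPow σ ((1 - t) / (2 * t))) t).trace.re

/-- `ψ(t) = sup_{ρ ∈ 𝒩} log Q_t^new(ρ‖σ)`, with `log 0 = -∞`. -/
def psi (𝒩 : Set (Matrix d d ℂ)) (σ : Matrix d d ℂ) (t : ℝ) : EReal :=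
  ⨆ ρ ∈ 𝒩, ENNReal.log (ENNReal.ofReal (Qnew t ρ σ))

/-- `φ(a) = sup_{0 < t ≤ 1} (a t - ψ(t))`. -/
def phi (𝒩 : Set (Matrix d d ℂ)) (σ : Matrix d d ℂ) (a : ℝ) : EReal :=
  ⨆ t ∈ Set.Ioc (0 : ℝ) 1, (((a * t : ℝ) : EReal) - psi 𝒩 σ t)

/-- `φ̂(a) = sup_{0 < t ≤ 1} (a (t - 1) - ψ(t))`. -/
def phiHat (𝒩 : Set (Matrix d d ℂ)) (σ : Matrix d d ℂ) (a : ℝ) : EReal :=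
  ⨆ t ∈ Set.Ioc (0 : ℝ) 1, (((a * (t - 1) : ℝ) : EReal) - psi 𝒩 σ t)

/-- `δ(F) = sup_{ρ ∈ 𝒩} inf_{ρ' ∈ F} ‖ρ - ρ'‖₁`; the infimum over the empty set is `∞`. -/
def netRadius (𝒩 : Set (Matrix d d ℂ)) (F : Finset (Matrix d d ℂ)) : ℝ≥0∞ :=
  ⨆ ρ ∈ 𝒩, ⨅ ρ' ∈ F, ENNReal.ofReal (traceNorm (ρ - ρ'))

/-- The Neyman-Pearson test `{e^{-na} ∑_{ρ ∈ F} ρ^{⊗ n} - σ^{⊗ n} > 0}`. -/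
def npTest (σ : Matrix d d ℂ) (F : Finset (Matrix d d ℂ)) (n : ℕ) (a : ℝ) :
    Matrix (Fin n → d) (Fin n → d) ℂ :=
  posProj (((Real.exp (-(n * a)) : ℝ) : ℂ) • (∑ ρ ∈ F, tensorPow n ρ) - tensorPow n σ)

/-- Worst-case type I error `sup_{ρ ∈ 𝒩} Tr ρ^{⊗ n} (I - T)`. -/
def typeI (𝒩 : Set (Matrix d d ℂ)) (n : ℕ) (T : Matrix (Fin n → d) (Fin n → d) ℂ) : ℝ≥0∞ :=
  ⨆ ρ ∈ 𝒩, ENNReal.ofReal ((tensorPow n ρ * (1 - T)).trace.re)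

/-- Type II error `Tr σ^{⊗ n} T`. -/
def typeII (σ : Matrix d d ℂ) (n : ℕ) (T : Matrix (Fin n → d) (Fin n → d) ℂ) : ℝ≥0∞ :=
  ENNReal.ofReal ((tensorPow n σ * T).trace.re)

/-- The exponential rate `limsup_n (1/n) log e_n`, with `log 0 = -∞`. -/
def expRate (e : ℕ → ℝ≥0∞) : EReal :=
  limsup (fun n : ℕ => ((1 / (n : ℝ) : ℝ) : EReal) * ENNReal.log (e n)) atTop

end

end CompositeStein

/-! Put A = e^{-na} ∑_{ρ ∈ F} ρ^{⊗n}, B = σ^{⊗n} and T = {A - B > 0}. Everything rests on one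
estimate, `npTest_error_le`: for 0 < t ≤ 1, Tr A(1-T) + Tr BT ≤ e^{-nat} ∑_{ρ ∈ F} Q_t(ρ‖σ)^n. For t
< 1 it chains three trace inequalities. Audenaert's bounds the left side by Tr A^t B^{1-t}.
Araki–Lieb–Thirring bounds that by Q_t(A‖B). Rotfel'd's splits Q_t(A‖B) into the sum over F, where
Q_t is multiplicative under tensor powers. At t = 1 the support condition gives Q_1 = 1 and the
estimate is elementary.

Since Q_t ≤ e^{ψ(t)}, dropping the first summand and optimising over t gives the type II bound with
φ. Dropping the second and dividing by e^{-na} gives φ̂, for the states of F. A state outside F is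
exchanged for its nearest point of F one tensor factor at a time, at total cost at most n‖ρ - ρ'‖₁
(`trace_tensorPow_mul_le`).

For the rates, (1 + 2e^{nκ})^D ≤ 3^D e^{nκD}, so the cardinality costs κD in the exponent, and the
net radius contributes the rate κ. -/

namespace CompositeStein

open Matrix

set_option linter.unusedSectionVars false

variable {d : Type*} [Fintype d] [DecidableEq d]

/-! ### Spectral calculus in an eigenbasis -/

/-- The matrix `U diag(D) U*`. -/
noncomputable def udiag (U : Matrix d d ℂ) (D : d → ℝ) : Matrix d d ℂ :=
  U * diagonal (fun i => (D i : ℂ)) * Uᴴ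

lemma udiag_mul {U : Matrix d d ℂ} (hU : Uᴴ * U = 1) (D E : d → ℝ) :
    udiag U D * udiag U E = udiag U (fun i => D i * E i) := by
  have : udiag U D * udiag U E
      = U * diagonal (fun i => (D i : ℂ)) * (Uᴴ * U) * diagonal (fun i => (E i : ℂ)) * Uᴴ := by
    simp only [udiag, Matrix.mul_assoc]
  rw [this, hU, Matrix.mul_one, Matrix.mul_assoc U, diagonal_mul_diagonal]
  simp [udiag]

lemma udiag_one {U : Matrix d d ℂ} (hU : Uᴴ * U = 1) : udiag U (fun _ => 1) = 1 := by
  simp [udiag, mul_eq_one_comm.mp hU]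

lemma udiag_sum {ι : Type*} (s : Finset ι) (U : Matrix d d ℂ) (D : ι → d → ℝ) :
    udiag U (fun i => ∑ k ∈ s, D k i) = ∑ k ∈ s, udiag U (D k) := by
  simp only [udiag]
  rw [← Finset.sum_mul, ← Finset.mul_sum]
  congr 2
  ext i j
  rw [Matrix.sum_apply]
  by_cases h : i = j
  · subst h; simp
  · simp [h]

lemma udiag_sub (U : Matrix d d ℂ) (D E : d → ℝ) :
    udiag U D - udiag U E = udiag U (fun i => D i - E i) := by
  simp only [udiag, ← Matrix.sub_mul, ← Matrix.mul_sub, diagonal_sub, Complex.ofReal_sub]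

lemma udiag_smul (c : ℝ) (U : Matrix d d ℂ) (D : d → ℝ) :
    udiag U (fun i => c * D i) = (c : ℂ) • udiag U D := by
  have : diagonal (fun i => ((c * D i : ℝ) : ℂ)) = (c : ℂ) • diagonal (fun i => (D i : ℂ)) := by
    ext i j
    by_cases h : i = j
    · subst h; simp
    · simp [h]
  rw [udiag, this]
  simp [udiag]

lemma isHermitian_udiag (U : Matrix d d ℂ) (D : d → ℝ) : (udiag U D).IsHermitian := by
  unfold udiag
  apply isHermitian_mul_mul_conjTranspose
  rw [IsHermitian, diagonal_conjTranspose]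
  congr 1
  ext i
  simp

lemma posSemidef_udiag (U : Matrix d d ℂ) {D : d → ℝ} (hD : ∀ i, 0 ≤ D i) :
    (udiag U D).PosSemidef := by
  unfold udiag
  apply PosSemidef.mul_mul_conjTranspose_same
  rw [posSemidef_diagonal_iff]
  intro i
  exact_mod_cast hD i

lemma trace_udiag {U : Matrix d d ℂ} (hU : Uᴴ * U = 1) (D : d → ℝ) :
    (udiag U D).trace = ((∑ i, D i : ℝ) : ℂ) := by
  rw [udiag, trace_mul_comm, ← Matrix.mul_assoc, hU, Matrix.one_mul, trace_diagonal]
  push_cast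
  rfl

lemma exists_udiag {A : Matrix d d ℂ} (hA : A.IsHermitian) :
    ∃ (U : Matrix d d ℂ) (D : d → ℝ), Uᴴ * U = 1 ∧ A = udiag U D := by
  refine ⟨hA.eigenvectorUnitary, hA.eigenvalues, ?_, ?_⟩
  · exact Unitary.coe_star_mul_self hA.eigenvectorUnitary
  · conv_lhs => rw [hA.spectral_theorem]
    rfl

lemma exists_udiag_of_posSemidef {A : Matrix d d ℂ} (hA : A.PosSemidef) :
    ∃ (U : Matrix d d ℂ) (D : d → ℝ), Uᴴ * U = 1 ∧ (∀ i, 0 ≤ D i) ∧ A = udiag U D := by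
  refine ⟨hA.1.eigenvectorUnitary, hA.1.eigenvalues, ?_, hA.eigenvalues_nonneg, ?_⟩
  · exact Unitary.coe_star_mul_self hA.1.eigenvectorUnitary
  · conv_lhs => rw [hA.1.spectral_theorem]
    rfl

lemma aeval_udiag {U : Matrix d d ℂ} (hU : Uᴴ * U = 1) (D : d → ℝ) (p : Polynomial ℝ) :
    Polynomial.aeval (udiag U D) p = udiag U (fun i => p.eval (D i)) := by
  have hpow : ∀ n : ℕ, udiag U D ^ n = udiag U (fun i => D i ^ n) := by
    intro n
    induction n with
    | zero => simp [udiag_one hU]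
    | succ n ih => rw [pow_succ, ih, udiag_mul hU]; simp [pow_succ]
  rw [Polynomial.aeval_eq_sum_range]
  simp_rw [hpow, Polynomial.eval_eq_sum_range]
  rw [udiag_sum]
  refine Finset.sum_congr rfl fun k _ => ?_
  rw [udiag_smul]
  ext i j
  simp

/-- On a finite spectrum every function is a polynomial, and polynomials act entrywise on the
diagonal. This reduces all later identities between powers to scalar ones. -/
lemma cfc_udiag {U : Matrix d d ℂ} (hU : Uᴴ * U = 1) (D : d → ℝ) (f : ℝ → ℝ) :
    cfc f (udiag U D) = udiag U (fun i => f (D i)) := by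
  have hsa : IsSelfAdjoint (udiag U D) := isHermitian_udiag U D
  have hfin : (spectrum ℝ (udiag U D)).Finite := by
    rw [(isHermitian_udiag U D).spectrum_real_eq_range_eigenvalues]
    exact Set.finite_range _
  -- Adding the entries of D to the nodes avoids having to show that they are the eigenvalues.
  set S : Finset ℝ := hfin.toFinset ∪ Finset.univ.image D with hS
  set p : Polynomial ℝ := Lagrange.interpolate S id f with hp
  have hev : ∀ x ∈ S, p.eval x = f x := by
    intro x hx
    exact Lagrange.eval_interpolate_at_node f (Set.injOn_id _) hx
  have h1 : cfc f (udiag U D) = cfc (fun x => p.eval x) (udiag U D) := by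
    apply cfc_congr
    intro x hx
    refine (hev x ?_).symm
    simp [hS, hx]
  rw [h1, cfc_polynomial p _ hsa, aeval_udiag hU]
  congr 1
  ext i
  exact hev _ (by simp [hS])

lemma psdPow_udiag {U : Matrix d d ℂ} (hU : Uᴴ * U = 1) (D : d → ℝ) (p : ℝ) :
    psdPow (udiag U D) p = udiag U (fun i => if 0 < D i then D i ^ p else 0) :=
  cfc_udiag hU D _

lemma posProj_udiag {U : Matrix d d ℂ} (hU : Uᴴ * U = 1) (D : d → ℝ) :
    posProj (udiag U D) = udiag U (fun i => if 0 < D i then 1 else 0) :=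
  cfc_udiag hU D _

lemma posSemidef_psdPow {A : Matrix d d ℂ} (hA : A.IsHermitian) (p : ℝ) :
    (psdPow A p).PosSemidef := by
  obtain ⟨U, D, hU, rfl⟩ := exists_udiag hA
  rw [psdPow_udiag hU]
  apply posSemidef_udiag
  intro i
  split_ifs with h
  · positivity
  · rfl

lemma psdPow_mul_psdPow {A : Matrix d d ℂ} (hA : A.IsHermitian) (p q : ℝ) :
    psdPow A p * psdPow A q = psdPow A (p + q) := by
  obtain ⟨U, D, hU, rfl⟩ := exists_udiag hA
  simp_rw [psdPow_udiag hU, udiag_mul hU]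
  congr 1
  ext i
  split_ifs with h
  · rw [Real.rpow_add h]
  · simp

lemma psdPow_one {A : Matrix d d ℂ} (hA : A.PosSemidef) : psdPow A 1 = A := by
  obtain ⟨U, D, hU, hD, rfl⟩ := exists_udiag_of_posSemidef hA
  rw [psdPow_udiag hU]
  congr 1
  ext i
  split_ifs with h
  · simp
  · exact le_antisymm (hD i) (not_lt.mp h)

lemma psdPow_smul {A : Matrix d d ℂ} (hA : A.IsHermitian) {c : ℝ} (hc : 0 < c) (p : ℝ) :
    psdPow ((c : ℂ) • A) p = ((c ^ p : ℝ) : ℂ) • psdPow A p := by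
  obtain ⟨U, D, hU, rfl⟩ := exists_udiag hA
  rw [← udiag_smul, psdPow_udiag hU, psdPow_udiag hU, ← udiag_smul]
  congr 1
  ext i
  by_cases h : 0 < D i
  · simp [h, hc, Real.mul_rpow hc.le h.le]
  · simp [h, hc]

/-- K Kᴴ and Kᴴ K have the same characteristic polynomial, hence the same eigenvalues with
multiplicity. -/
lemma psdPow_mul_conjTranspose_trace (K : Matrix d d ℂ) (p : ℝ) :
    (psdPow (K * Kᴴ) p).trace = (psdPow (Kᴴ * K) p).trace := by
  have h1 := isHermitian_mul_conjTranspose_self K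
  have h2 := isHermitian_conjTranspose_mul_self K
  have h3 : h1.eigenvalues = h2.eigenvalues :=
    (IsHermitian.eigenvalues_eq_eigenvalues_iff h1 h2).mpr (charpoly_mul_comm _ _)
  have key : ∀ {A : Matrix d d ℂ} (hA : A.IsHermitian), (psdPow A p).trace
      = ((∑ i, (if 0 < hA.eigenvalues i then hA.eigenvalues i ^ p else 0) : ℝ) : ℂ) := by
    intro A hA
    have hA' : A = udiag hA.eigenvectorUnitary hA.eigenvalues := by
      conv_lhs => rw [hA.spectral_theorem]
      rfl
    have hU : (hA.eigenvectorUnitary : Matrix d d ℂ)ᴴ * hA.eigenvectorUnitary = 1 :=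
      Unitary.coe_star_mul_self hA.eigenvectorUnitary
    have h := psdPow_udiag hU hA.eigenvalues p
    rw [← hA'] at h
    rw [h, trace_udiag hU]
  rw [key h1, key h2, h3]

/-! ### Operator monotonicity and positivity of traces -/

section OperatorMonotone

open scoped MatrixOrder Matrix.Norms.L2Operator

/-- For a positive exponent 0^p = 0, so the power on the support is the usual one and operator
monotonicity transfers to `psdPow`. -/
lemma psdPow_eq_rpow {A : Matrix d d ℂ} (hA : A.PosSemidef) {p : ℝ} (hp : 0 < p) :
    psdPow A p = A ^ p := by
  rw [CFC.rpow_eq_cfc_real (ha := hA.nonneg)]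
  apply cfc_congr
  intro x hx
  have hx0 : 0 ≤ x := spectrum_nonneg_of_nonneg hA.nonneg hx
  rcases hx0.eq_or_lt with h | h
  · simp [← h, Real.zero_rpow hp.ne']
  · simp [h]

/-- The **Löwner–Heinz theorem** for matrices. -/
lemma psdPow_mono {A B : Matrix d d ℂ} (hA : A.PosSemidef) (hAB : (B - A).PosSemidef) {p : ℝ}
    (hp : 0 < p) (hp1 : p ≤ 1) : (psdPow B p - psdPow A p).PosSemidef := by
  have hB : B.PosSemidef := by simpa using hA.add hAB
  rw [psdPow_eq_rpow hA hp, psdPow_eq_rpow hB hp]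
  exact CFC.rpow_le_rpow ⟨hp.le, hp1⟩ (le_iff.mpr hAB)

end OperatorMonotone

lemma trace_mul_nonneg_complex {P Q : Matrix d d ℂ} (hP : P.PosSemidef) (hQ : Q.PosSemidef) :
    0 ≤ (P * Q).trace := by
  have h : P = psdPow P (1 / 2) * psdPow P (1 / 2) := by
    rw [psdPow_mul_psdPow hP.1]
    norm_num [psdPow_one hP]
  have h2 := (posSemidef_psdPow hP.1 (1 / 2)).1
  rw [h, Matrix.mul_assoc, trace_mul_comm]
  have := (hQ.mul_mul_conjTranspose_same (psdPow P (1 / 2))).trace_nonneg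
  rwa [h2.eq] at this

lemma trace_mul_nonneg {P Q : Matrix d d ℂ} (hP : P.PosSemidef) (hQ : Q.PosSemidef) :
    0 ≤ (P * Q).trace.re :=
  (Complex.le_def.mp (trace_mul_nonneg_complex hP hQ)).1

lemma trace_re_nonneg {P : Matrix d d ℂ} (hP : P.PosSemidef) : 0 ≤ P.trace.re := by
  simpa using trace_mul_nonneg hP (PosSemidef.one (n := d) (R := ℂ))

lemma trace_mul_mono_left {P P' Q : Matrix d d ℂ} (h : (P' - P).PosSemidef)
    (hQ : Q.PosSemidef) : (P * Q).trace.re ≤ (P' * Q).trace.re := by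
  have := trace_mul_nonneg h hQ
  simpa [Matrix.sub_mul] using this

lemma trace_mul_mono_right {P Q Q' : Matrix d d ℂ} (hP : P.PosSemidef)
    (h : (Q' - Q).PosSemidef) : (P * Q).trace.re ≤ (P * Q').trace.re := by
  have := trace_mul_nonneg hP h
  simpa [Matrix.mul_sub] using this

lemma trace_psdPow_mono {A B : Matrix d d ℂ} (hA : A.PosSemidef) (hAB : (B - A).PosSemidef)
    {p : ℝ} (hp : 0 < p) (hp1 : p ≤ 1) : (psdPow A p).trace.re ≤ (psdPow B p).trace.re := by
  simpa using trace_re_nonneg (psdPow_mono hA hAB hp hp1)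

/-! ### Audenaert's inequality -/

lemma posSemidef_posProj (X : Matrix d d ℂ) (hX : X.IsHermitian) : (posProj X).PosSemidef := by
  obtain ⟨U, D, hU, rfl⟩ := exists_udiag hX
  rw [posProj_udiag hU]
  exact posSemidef_udiag U fun i => by split_ifs <;> simp

lemma posSemidef_one_sub_posProj (X : Matrix d d ℂ) (hX : X.IsHermitian) :
    (1 - posProj X).PosSemidef := by
  obtain ⟨U, D, hU, rfl⟩ := exists_udiag hX
  have : 1 - posProj (udiag U D) = udiag U (fun i => if 0 < D i then 0 else 1) := by
    rw [posProj_udiag hU, ← udiag_one hU, udiag_sub]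
    congr 1
    ext i
    split_ifs <;> simp
  rw [this]
  exact posSemidef_udiag U fun i => by split_ifs <;> simp

/-- The positive part `X {X > 0}` of a self-adjoint matrix dominates `0` and `X`. -/
lemma posSemidef_mul_posProj (X : Matrix d d ℂ) (hX : X.IsHermitian) :
    (X * posProj X).PosSemidef ∧ (X * posProj X - X).PosSemidef := by
  obtain ⟨U, D, hU, rfl⟩ := exists_udiag hX
  rw [posProj_udiag hU, udiag_mul hU]
  constructor
  · refine posSemidef_udiag U fun i => ?_
    split_ifs with h
    · simpa using h.le
    · simp
  · rw [udiag_sub]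
    refine posSemidef_udiag U fun i => ?_
    split_ifs with h
    · simp
    · simpa using h

/-- **Audenaert's inequality**, by Ozawa's argument. -/
lemma trace_error_le_trace_psdPow_mul {A B : Matrix d d ℂ} (hA : A.PosSemidef)
    (hB : B.PosSemidef) {t : ℝ} (ht : 0 < t) (ht1 : t < 1) :
    (A * (1 - posProj (A - B))).trace.re + (B * posProj (A - B)).trace.re
      ≤ (psdPow A t * psdPow B (1 - t)).trace.re := by
  obtain ⟨hP0, hPX⟩ := posSemidef_mul_posProj (A - B) (hA.1.sub hB.1)
  set P := (A - B) * posProj (A - B) with hP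
  -- C = B + (A - B)₊ dominates both A and B. By Löwner–Heinz, Tr A - Tr A^t B^{1-t} ≤ Tr A^t
  -- (C^{1-t} - B^{1-t}) ≤ Tr C^t (C^{1-t} - B^{1-t}) ≤ Tr C - Tr B = Tr (A - B)₊. The three
  -- inequalities are `i1`, `i2`, `i3`.
  set C := B + P with hCdef
  have hC : C.PosSemidef := hB.add hP0
  have hBC : (C - B).PosSemidef := by simpa [hCdef] using hP0
  have hAC : (C - A).PosSemidef := by
    have : C - A = P - (A - B) := by rw [hCdef]; abel
    rw [this]; exact hPX
  have ht' : 0 < 1 - t := by linarith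
  have e1 : (psdPow A t * psdPow A (1 - t)).trace.re = A.trace.re := by
    rw [psdPow_mul_psdPow hA.1, add_sub_cancel, psdPow_one hA]
  have e2 : (psdPow C t * psdPow C (1 - t)).trace.re = C.trace.re := by
    rw [psdPow_mul_psdPow hC.1, add_sub_cancel, psdPow_one hC]
  have e3 : (psdPow B t * psdPow B (1 - t)).trace.re = B.trace.re := by
    rw [psdPow_mul_psdPow hB.1, add_sub_cancel, psdPow_one hB]
  have i1 := trace_mul_mono_right (posSemidef_psdPow hA.1 t)
    (psdPow_mono hA hAC ht' (by linarith))
  have i2 := trace_mul_mono_left (psdPow_mono hA hAC ht ht1.le)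
    (psdPow_mono hB hBC ht' (by linarith))
  have i3 := trace_mul_mono_left (psdPow_mono hB hBC ht ht1.le)
    (posSemidef_psdPow hB.1 (1 - t))
  have e4 : C.trace.re = B.trace.re + P.trace.re := by simp [hCdef]
  have e5 : (A * (1 - posProj (A - B))).trace.re + (B * posProj (A - B)).trace.re
      = A.trace.re - P.trace.re := by
    simp [hP, Matrix.mul_sub, Matrix.sub_mul]
    ring
  simp only [Matrix.mul_sub, trace_sub, Complex.sub_re] at i2
  rw [e5]
  linarith

/-! ### Trace Jensen and Rotfel'd inequalities -/

lemma diag_conj_udiag (W U : Matrix d d ℂ) (D : d → ℝ) (i : d) :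
    ((Wᴴ * udiag U D * W) i i).re = ∑ j, ‖(Uᴴ * W) j i‖ ^ 2 * D j := by
  have : Wᴴ * udiag U D * W = (Uᴴ * W)ᴴ * diagonal (fun i => (D i : ℂ)) * (Uᴴ * W) := by
    simp [udiag, conjTranspose_mul, Matrix.mul_assoc]
  rw [this, Matrix.mul_apply, Complex.re_sum]
  refine Finset.sum_congr rfl fun j _ => ?_
  rw [mul_diagonal, conjTranspose_apply, mul_right_comm, ← Complex.normSq_eq_norm_sq]
  rw [Complex.star_def, ← Complex.normSq_eq_conj_mul_self, ← Complex.ofReal_mul,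
    Complex.ofReal_re]

/-- In an eigenbasis of A the i-th diagonal entry averages the eigenvalues with weights of total
mass at most 1, so this is Jensen for the concave x^s. -/
lemma diag_psdPow_le {A W : Matrix d d ℂ} (hA : A.PosSemidef) {s : ℝ} (hs : 0 < s)
    (hs1 : s ≤ 1) (i : d) (hW : ((Wᴴ * W) i i).re ≤ 1) :
    ((Wᴴ * psdPow A s * W) i i).re ≤ ((Wᴴ * A * W) i i).re ^ s := by
  obtain ⟨U, D, hU, hD, rfl⟩ := exists_udiag_of_posSemidef hA
  rw [psdPow_udiag hU, diag_conj_udiag, diag_conj_udiag]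
  have hW' : ∑ j, ‖(Uᴴ * W) j i‖ ^ 2 ≤ 1 := by
    have := diag_conj_udiag W U (fun _ => 1) i
    rw [udiag_one hU, Matrix.mul_one] at this
    simp only [mul_one] at this
    rwa [← this]
  set w : d → ℝ := fun j => ‖(Uᴴ * W) j i‖ ^ 2 with hw
  have hw0 : ∀ j, 0 ≤ w j := fun j => by positivity
  have hf : ∀ j, (if 0 < D j then D j ^ s else 0) = D j ^ s := by
    intro j
    split_ifs with h
    · rfl
    · rw [le_antisymm (not_lt.mp h) (hD j), Real.zero_rpow hs.ne']
  simp_rw [hf]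
  -- The extra point `none` carries the missing mass at the value 0, where x^s vanishes.
  have hc := (Real.concaveOn_rpow hs.le hs1).le_map_sum (t := (Finset.univ : Finset (Option d)))
    (w := fun o => o.elim (1 - ∑ j, w j) w) (p := fun o => o.elim 0 D)
    (by rintro (_ | j) _
        · simpa using hW'
        · exact hw0 j)
    (by simp [Fintype.sum_option])
    (by rintro (_ | j) _
        · simp
        · exact hD j)
  simpa [Fintype.sum_option, Real.zero_rpow hs.ne'] using hc

/-- Trace Jensen inequality for powers in `(0, 1]` and contractions. -/
lemma trace_conj_psdPow_le {A K : Matrix d d ℂ} (hA : A.PosSemidef)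
    (hK : (1 - Kᴴ * K).PosSemidef) {s : ℝ} (hs : 0 < s) (hs1 : s ≤ 1) :
    (Kᴴ * psdPow A s * K).trace.re ≤ (psdPow (Kᴴ * A * K) s).trace.re := by
  -- In an eigenbasis U of Kᴴ A K the right-hand trace is a sum of s-th powers of diagonal entries,
  -- so the scalar estimate applies to each column of W = K U.
  obtain ⟨U, D, hU, hD, h⟩ := exists_udiag_of_posSemidef (hA.conjTranspose_mul_mul_same K)
  have hU' := mul_eq_one_comm.mp hU
  have hdiag : Uᴴ * (Kᴴ * A * K) * U = diagonal (fun i => (D i : ℂ)) := by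
    rw [h, udiag]
    calc _ = Uᴴ * U * diagonal (fun i => (D i : ℂ)) * (Uᴴ * U) := by
            simp only [Matrix.mul_assoc]
      _ = _ := by rw [hU]; simp
  have hl : (Kᴴ * psdPow A s * K).trace = ∑ i, ((K * U)ᴴ * psdPow A s * (K * U)) i i := by
    change _ = trace _
    have e : (K * U)ᴴ * psdPow A s * (K * U) = Uᴴ * (Kᴴ * psdPow A s * K * U) := by
      simp only [conjTranspose_mul, Matrix.mul_assoc]
    rw [e, trace_mul_comm Uᴴ, Matrix.mul_assoc _ U, hU', Matrix.mul_one]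
  rw [hl, h, psdPow_udiag hU, trace_udiag hU, Complex.re_sum, Complex.ofReal_re]
  refine Finset.sum_le_sum fun i _ => ?_
  refine (diag_psdPow_le hA hs hs1 i ?_).trans ?_
  · have := (hK.conjTranspose_mul_mul_same U).diag_nonneg (i := i)
    have e : Uᴴ * (1 - Kᴴ * K) * U = 1 - (K * U)ᴴ * (K * U) := by
      rw [Matrix.mul_sub, Matrix.sub_mul, Matrix.mul_one, hU, conjTranspose_mul]
      simp only [Matrix.mul_assoc]
    rw [e] at this
    have := (Complex.le_def.mp this).1
    simpa using this
  · have e : (K * U)ᴴ * A * (K * U) = diagonal (fun i => (D i : ℂ)) := by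
      rw [← hdiag, conjTranspose_mul]
      simp only [Matrix.mul_assoc]
    rw [e, diagonal_apply_eq, Complex.ofReal_re]
    split_ifs with h
    · rfl
    · rw [le_antisymm (not_lt.mp h) (hD i), Real.zero_rpow hs.ne']

/-- 1 - KᴴK = Kᴴ(1 - KKᴴ)K + (1 - KᴴK)², a sum of two positive terms. -/
lemma posSemidef_one_sub_conjTranspose_mul_self {K : Matrix d d ℂ}
    (hK : (1 - K * Kᴴ).PosSemidef) : (1 - Kᴴ * K).PosSemidef := by
  have h1 := hK.conjTranspose_mul_mul_same K
  have h2 := posSemidef_conjTranspose_mul_self (1 - Kᴴ * K)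
  have : 1 - Kᴴ * K = Kᴴ * (1 - K * Kᴴ) * K + (1 - Kᴴ * K)ᴴ * (1 - Kᴴ * K) := by
    simp only [conjTranspose_sub, conjTranspose_mul, conjTranspose_conjTranspose,
      conjTranspose_one]
    noncomm_ring
  rw [this]
  exact h1.add h2

lemma psdPow_half_mul_self {A : Matrix d d ℂ} (hA : A.PosSemidef) :
    psdPow A (1 / 2) * psdPow A (1 / 2) = A := by
  rw [psdPow_mul_psdPow hA.1, add_halves, psdPow_one hA]

lemma posSemidef_one_sub_psdPow_zero {A : Matrix d d ℂ} (hA : A.IsHermitian) :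
    (1 - psdPow A 0).PosSemidef := by
  obtain ⟨U, D, hU, rfl⟩ := exists_udiag hA
  rw [psdPow_udiag hU, ← udiag_one hU, udiag_sub]
  exact posSemidef_udiag U fun i => by split_ifs <;> simp

/-- X ≤ C forces ker C ⊆ ker X: if E projects onto ker C, then 0 ≤ Tr E(C - X)E = -Tr EXE, hence
X^{1/2}E = 0. -/
lemma psdPow_half_mul_psdPow_zero {X C : Matrix d d ℂ} (hX : X.PosSemidef)
    (hXC : (C - X).PosSemidef) : psdPow X (1 / 2) * psdPow C 0 = psdPow X (1 / 2) := by
  have hC : C.PosSemidef := by simpa using hX.add hXC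
  have hXh := posSemidef_psdPow hX.1 (1 / 2)
  have hE := posSemidef_one_sub_psdPow_zero hC.1
  set E := 1 - psdPow C 0 with hEdef
  have hCE : C * E = 0 := by
    have : C * psdPow C 0 = C := by
      nth_rw 1 [← psdPow_one hC]
      rw [psdPow_mul_psdPow hC.1, add_zero, psdPow_one hC]
    rw [hEdef, Matrix.mul_sub, this, Matrix.mul_one, sub_self]
  have h1 : (psdPow X (1 / 2) * E)ᴴ * (psdPow X (1 / 2) * E) = Eᴴ * X * E := by
    rw [conjTranspose_mul, hXh.1.eq, ← Matrix.mul_assoc, Matrix.mul_assoc Eᴴ,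
      psdPow_half_mul_self hX]
  have h2 : Eᴴ * (C - X) * E = -(Eᴴ * X * E) := by
    rw [Matrix.mul_assoc, Matrix.sub_mul, hCE, zero_sub, Matrix.mul_neg, Matrix.mul_assoc]
  have h3 := (hXC.conjTranspose_mul_mul_same E).trace_nonneg
  have h4 := (hX.conjTranspose_mul_mul_same E).trace_nonneg
  rw [h2, trace_neg, neg_nonneg] at h3
  have h5 := le_antisymm h3 h4
  rw [← h1, trace_conjTranspose_mul_self_eq_zero_iff, hEdef, Matrix.mul_sub, Matrix.mul_one,
    sub_eq_zero] at h5
  exact h5.symm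

/-- **Rotfel'd's inequality**: `X ↦ Tr X ^ s` is subadditive for `0 < s ≤ 1`. -/
lemma trace_psdPow_sum_le {ι : Type*} (S : Finset ι) (X : ι → Matrix d d ℂ)
    (hX : ∀ i ∈ S, (X i).PosSemidef) {s : ℝ} (hs : 0 < s) (hs1 : s ≤ 1) :
    (psdPow (∑ i ∈ S, X i) s).trace.re ≤ ∑ i ∈ S, (psdPow (X i) s).trace.re := by
  classical
  set C := ∑ i ∈ S, X i with hCdef
  have hC : C.PosSemidef := posSemidef_sum S hX
  have hN := posSemidef_psdPow hC.1 (-(1 / 2))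
  set N := psdPow C (-(1 / 2)) with hNdef
  have hNC : N * C * N = psdPow C 0 := by
    nth_rw 1 [← psdPow_one hC]
    rw [hNdef, psdPow_mul_psdPow hC.1, psdPow_mul_psdPow hC.1]
    norm_num
  have hCs : psdPow C s * psdPow C 0 = psdPow C s := by
    rw [psdPow_mul_psdPow hC.1, add_zero]
  -- With N = C^{-1/2} and K = N X_i^{1/2} one has Kᴴ C K = X_i and K Kᴴ = N X_i N ≤ 1. Trace Jensen
  -- for this contraction is the claim, and the operators N X_i N sum to the support projection of
  -- C, so the left sides sum to Tr C^s.
  have hterm : ∀ i ∈ S,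
      (psdPow C s * (N * X i * N)).trace.re ≤ (psdPow (X i) s).trace.re := by
    intro i hi
    have hXC : (C - X i).PosSemidef := by
      have : C - X i = ∑ j ∈ S.erase i, X j := by
        rw [sub_eq_iff_eq_add, hCdef, Finset.sum_erase_add _ _ hi]
      rw [this]
      exact posSemidef_sum _ fun j hj => hX j (Finset.mem_of_mem_erase hj)
    have hR := posSemidef_psdPow (hX i hi).1 (1 / 2)
    set R := psdPow (X i) (1 / 2) with hRdef
    have hRR : R * R = X i := psdPow_half_mul_self (hX i hi)
    have hKK : (N * R) * (N * R)ᴴ = N * X i * N := by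
      rw [conjTranspose_mul, hR.1.eq, hN.1.eq, ← hRR]
      simp only [Matrix.mul_assoc]
    have hKCK : (N * R)ᴴ * C * (N * R) = X i := by
      have : (N * R)ᴴ * C * (N * R) = R * (N * C * N) * R := by
        rw [conjTranspose_mul, hR.1.eq, hN.1.eq]
        simp only [Matrix.mul_assoc]
      rw [this, hNC, psdPow_half_mul_psdPow_zero (hX i hi) hXC, hRR]
    have hK : (1 - (N * R) * (N * R)ᴴ).PosSemidef := by
      have h1 := hXC.conjTranspose_mul_mul_same N
      have h2 := posSemidef_one_sub_psdPow_zero hC.1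
      rw [hN.1.eq, Matrix.mul_sub, Matrix.sub_mul, hNC, ← hKK] at h1
      simpa using h2.add h1
    have h := trace_conj_psdPow_le hC (posSemidef_one_sub_conjTranspose_mul_self hK) hs hs1
    rw [hKCK, Matrix.mul_assoc, trace_mul_comm, Matrix.mul_assoc, hKK] at h
    exact h
  refine le_trans (le_of_eq ?_) (Finset.sum_le_sum hterm)
  rw [← Complex.re_sum, ← trace_sum, ← Finset.mul_sum, ← Finset.sum_mul, ← Finset.mul_sum,
    ← hCdef, hNC, hCs]

/-- With Z = Y^{1/2}, the operator KᴴYK = (ZK)ᴴ(ZK) has the spectrum of Z K Kᴴ Z ≤ Y, and the trace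
of the s-th power is monotone. -/
lemma trace_psdPow_conj_le {Y K : Matrix d d ℂ} (hY : Y.PosSemidef)
    (hK : (1 - K * Kᴴ).PosSemidef) {s : ℝ} (hs : 0 < s) (hs1 : s ≤ 1) :
    (psdPow (Kᴴ * Y * K) s).trace.re ≤ (psdPow Y s).trace.re := by
  have hZ := posSemidef_psdPow hY.1 (1 / 2)
  have hZZ := psdPow_half_mul_self hY
  set Z := psdPow Y (1 / 2)
  have h1 : Kᴴ * Y * K = (Z * K)ᴴ * (Z * K) := by
    rw [conjTranspose_mul, hZ.1.eq, ← hZZ]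
    simp only [Matrix.mul_assoc]
  rw [h1, ← psdPow_mul_conjTranspose_trace]
  refine trace_psdPow_mono (posSemidef_self_mul_conjTranspose _) ?_ hs hs1
  have h2 : Y - Z * K * (Z * K)ᴴ = Zᴴ * (1 - K * Kᴴ) * Z := by
    rw [conjTranspose_mul, hZ.1.eq, Matrix.mul_sub, Matrix.sub_mul, Matrix.mul_one, hZZ]
    simp only [Matrix.mul_assoc]
  rw [h2]
  exact hK.conjTranspose_mul_mul_same Z

/-! ### Araki–Lieb–Thirring with an eigenvalue-counting factor -/

/-- The Araki–Lieb–Thirring inequality up to the number of distinct eigenvalues of `B`. -/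
lemma trace_psdPow_mul_udiag_le {A U : Matrix d d ℂ} (hA : A.PosSemidef) (hU : Uᴴ * U = 1)
    (b : d → ℝ) {s : ℝ} (hs : 0 < s) (hs1 : s ≤ 1) :
    (psdPow A s * psdPow (udiag U b) (1 - s)).trace.re
      ≤ (Finset.univ.image b).card *
        (psdPow (psdPow (udiag U b) ((1 - s) / (2 * s)) * A *
          psdPow (udiag U b) ((1 - s) / (2 * s))) s).trace.re := by
  set S := Finset.univ.image b
  have hB' := posSemidef_psdPow (isHermitian_udiag U b) ((1 - s) / (2 * s))
  set B' := psdPow (udiag U b) ((1 - s) / (2 * s)) with hB'def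
  set Y := B' * A * B' with hYdef
  have hY : Y.PosSemidef := by
    have := hA.conjTranspose_mul_mul_same B'
    rwa [hB'.1.eq] at this
  -- E k is the spectral projection of B at k. Each k > 0 contributes k^{1-s} Tr E A^s E ≤ k^{1-s}
  -- Tr (EAE)^s = Tr (EYE)^s ≤ Tr Y^s, because EYE = k^{(1-s)/s} EAE. The number of terms is the
  -- number of distinct eigenvalues.
  set E : ℝ → Matrix d d ℂ := fun k => udiag U (fun i => if b i = k then 1 else 0) with hE
  have hEh : ∀ k, (E k).IsHermitian := fun k => isHermitian_udiag _ _
  have hEE : ∀ k, E k * E k = E k := by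
    intro k
    simp only [hE, udiag_mul hU]
    congr 1
    ext i
    split_ifs <;> simp
  have hE1 : ∀ k, (1 - E k * (E k)ᴴ).PosSemidef := by
    intro k
    rw [(hEh k).eq, hEE]
    simp only [hE]
    rw [← udiag_one hU, udiag_sub]
    exact posSemidef_udiag U fun i => by split_ifs <;> simp
  set c : ℝ → ℝ := fun k => if 0 < k then k ^ (1 - s) else 0 with hc
  have hB : psdPow (udiag U b) (1 - s) = ∑ k ∈ S, (c k : ℂ) • E k := by
    rw [psdPow_udiag hU]
    simp only [hE, ← udiag_smul]
    rw [← udiag_sum]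
    congr 1
    ext i
    simp [hc, S]
  rw [hB, Finset.mul_sum, trace_sum, Complex.re_sum, ← nsmul_eq_mul]
  refine Finset.sum_le_card_nsmul _ _ _ fun k hk => ?_
  by_cases hk0 : 0 < k
  · have h1 := trace_conj_psdPow_le hA
      (posSemidef_one_sub_conjTranspose_mul_self (hE1 k)) hs hs1
    have h2 := trace_psdPow_conj_le hY (hE1 k) hs hs1
    rw [(hEh k).eq] at h1 h2
    have hg : 0 < k ^ ((1 - s) / s) := Real.rpow_pos_of_pos hk0 _
    have hEB : E k * B' = ((k ^ ((1 - s) / (2 * s)) : ℝ) : ℂ) • E k := by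
      simp only [hE, hB'def, psdPow_udiag hU, udiag_mul hU, ← udiag_smul]
      congr 1
      ext i
      split_ifs with h h' h'
      · simp [h]
      · exact absurd (h ▸ hk0) h'
      · simp
      · simp
    have hBE : B' * E k = ((k ^ ((1 - s) / (2 * s)) : ℝ) : ℂ) • E k := by
      simp only [hE, hB'def, psdPow_udiag hU, udiag_mul hU, ← udiag_smul]
      congr 1
      ext i
      split_ifs with h h' h'
      · simp [h']
      · simp
      · exact absurd (h' ▸ hk0) h
      · simp
    have hkk : k ^ ((1 - s) / (2 * s)) * k ^ ((1 - s) / (2 * s)) = k ^ ((1 - s) / s) := by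
      rw [← Real.rpow_add hk0]
      congr 1
      field_simp
      ring
    have hEYE : E k * Y * E k = ((k ^ ((1 - s) / s) : ℝ) : ℂ) • (E k * A * E k) := by
      have : E k * Y * E k = (E k * B') * A * (B' * E k) := by
        rw [hYdef]
        simp only [Matrix.mul_assoc]
      rw [this, hEB, hBE, ← hkk]
      simp only [Matrix.smul_mul, Matrix.mul_smul, smul_smul, Complex.ofReal_mul]
    have hEAE : (E k * A * E k).IsHermitian := by
      have := (hA.conjTranspose_mul_mul_same (E k)).1
      rwa [(hEh k).eq] at this
    rw [hEYE, psdPow_smul hEAE hg, ← Real.rpow_mul hk0.le, div_mul_cancel₀ _ hs.ne',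
      trace_smul, smul_eq_mul, Complex.re_ofReal_mul] at h2
    have hck : c k = k ^ (1 - s) := by simp [hc, hk0]
    have h3 : (psdPow A s * E k).trace = (E k * psdPow A s * E k).trace := by
      rw [trace_mul_comm, trace_mul_comm _ (E k), ← Matrix.mul_assoc, hEE]
    rw [Matrix.mul_smul, trace_smul, smul_eq_mul, Complex.re_ofReal_mul, hck, h3]
    exact (mul_le_mul_of_nonneg_left h1 (Real.rpow_nonneg hk0.le _)).trans h2
  · have hck : c k = 0 := by simp [hc, hk0]
    simpa [hck] using trace_re_nonneg (posSemidef_psdPow hY.1 s)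

/-! ### Tensor powers -/

/-- The tensor product of a finite family of matrices. -/
def piTensor {n : ℕ} (M : Fin n → Matrix d d ℂ) : Matrix (Fin n → d) (Fin n → d) ℂ :=
  Matrix.of fun f g => ∏ i, M i (f i) (g i)

lemma piTensor_mul {n : ℕ} (M N : Fin n → Matrix d d ℂ) :
    piTensor M * piTensor N = piTensor (fun i => M i * N i) := by
  ext f g
  simp only [piTensor, Matrix.mul_apply, of_apply, ← Finset.prod_mul_distrib]
  rw [Finset.prod_univ_sum, Fintype.piFinset_univ]

lemma piTensor_conjTranspose {n : ℕ} (M : Fin n → Matrix d d ℂ) :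
    (piTensor M)ᴴ = piTensor (fun i => (M i)ᴴ) := by
  ext f g
  simp [piTensor, conjTranspose_apply]

lemma trace_piTensor {n : ℕ} (M : Fin n → Matrix d d ℂ) :
    (piTensor M).trace = ∏ i, (M i).trace := by
  simp only [piTensor, trace, diag_apply, of_apply]
  rw [Finset.prod_univ_sum, Fintype.piFinset_univ]

lemma posSemidef_piTensor {n : ℕ} {M : Fin n → Matrix d d ℂ} (hM : ∀ i, (M i).PosSemidef) :
    (piTensor M).PosSemidef := by
  have h : piTensor M = (piTensor fun i => psdPow (M i) (1 / 2))ᴴ *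
      piTensor fun i => psdPow (M i) (1 / 2) := by
    rw [piTensor_conjTranspose, piTensor_mul]
    congr 1
    ext1 i
    rw [(posSemidef_psdPow (hM i).1 _).1.eq, psdPow_half_mul_self (hM i)]
  rw [h]
  exact posSemidef_conjTranspose_mul_self _

lemma tensorPow_eq_piTensor (n : ℕ) (A : Matrix d d ℂ) :
    tensorPow n A = piTensor fun _ => A := rfl

lemma tensorPow_mul (n : ℕ) (A B : Matrix d d ℂ) :
    tensorPow n A * tensorPow n B = tensorPow n (A * B) :=
  piTensor_mul _ _

lemma trace_tensorPow (n : ℕ) (A : Matrix d d ℂ) : (tensorPow n A).trace = A.trace ^ n := by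
  simp [tensorPow_eq_piTensor, trace_piTensor]

lemma posSemidef_tensorPow (n : ℕ) {A : Matrix d d ℂ} (hA : A.PosSemidef) :
    (tensorPow n A).PosSemidef :=
  posSemidef_piTensor fun _ => hA

lemma tensorPow_diagonal (n : ℕ) (D : d → ℂ) :
    tensorPow n (diagonal D) = diagonal fun f => ∏ i, D (f i) := by
  ext f g
  simp only [tensorPow, of_apply, diagonal_apply]
  split_ifs with h
  · simp [h]
  · obtain ⟨i, hi⟩ := Function.ne_iff.mp h
    exact Finset.prod_eq_zero (Finset.mem_univ i) (if_neg hi)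

lemma tensorPow_conjTranspose (n : ℕ) (A : Matrix d d ℂ) :
    (tensorPow n A)ᴴ = tensorPow n Aᴴ :=
  piTensor_conjTranspose _

lemma tensorPow_udiag (n : ℕ) (U : Matrix d d ℂ) (D : d → ℝ) :
    tensorPow n (udiag U D) = udiag (tensorPow n U) fun f => ∏ i, D (f i) := by
  simp only [udiag, ← tensorPow_mul, tensorPow_diagonal, tensorPow_conjTranspose,
    Complex.ofReal_prod]

lemma tensorPow_unitary (n : ℕ) {U : Matrix d d ℂ} (hU : Uᴴ * U = 1) :
    (tensorPow n U)ᴴ * tensorPow n U = 1 := by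
  rw [tensorPow_conjTranspose, tensorPow_mul, hU, ← diagonal_one, tensorPow_diagonal]
  simp

lemma psdPow_tensorPow (n : ℕ) {A : Matrix d d ℂ} (hA : A.PosSemidef) (p : ℝ) :
    psdPow (tensorPow n A) p = tensorPow n (psdPow A p) := by
  obtain ⟨U, D, hU, hD, rfl⟩ := exists_udiag_of_posSemidef hA
  rw [tensorPow_udiag, psdPow_udiag (tensorPow_unitary n hU), psdPow_udiag hU, tensorPow_udiag]
  congr 1
  ext f
  by_cases h : ∀ i, 0 < D (f i)
  · rw [if_pos (Finset.prod_pos fun i _ => h i), ← Real.finsetProd_rpow _ _ fun i _ => hD _]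
    exact Finset.prod_congr rfl fun i _ => (if_pos (h i)).symm
  -- One zero eigenvalue kills the product. Both sides are then 0 for every exponent, since powers
  -- live on the support.
  · push Not at h
    obtain ⟨i, hi⟩ := h
    have h0 : ∏ i, D (f i) = 0 :=
      Finset.prod_eq_zero (Finset.mem_univ i) (le_antisymm hi (hD _))
    rw [if_neg (by simp [h0])]
    exact (Finset.prod_eq_zero (Finset.mem_univ i) (if_neg (not_lt.mpr hi))).symm

/-! ### The tensor power trick -/

/-- The product depends only on how often each index occurs, and each multiplicity lies between 0
and m. Hence σ^{⊗m} has only polynomially many distinct eigenvalues. -/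
lemma card_image_prod_le (m : ℕ) (b : d → ℝ) :
    (Finset.univ.image fun f : Fin m → d => ∏ i, b (f i)).card
      ≤ (m + 1) ^ Fintype.card d := by
  have hsub : (Finset.univ.image fun f : Fin m → d => ∏ i, b (f i))
      ⊆ Finset.univ.image fun c : d → Fin (m + 1) => ∏ j, b j ^ (c j : ℕ) := by
    intro x hx
    obtain ⟨f, -, rfl⟩ := Finset.mem_image.mp hx
    refine Finset.mem_image.mpr
      ⟨fun j => ⟨(Finset.univ.filter fun i => f i = j).card, ?_⟩, Finset.mem_univ _, ?_⟩
    · exact Nat.lt_succ_of_le ((Finset.card_le_univ _).trans (by simp))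
    · have := Finset.prod_fiberwise' (Finset.univ : Finset (Fin m)) f b
      rw [← this]
      simp
  calc _ ≤ _ := Finset.card_le_card hsub
    _ ≤ (Finset.univ : Finset (d → Fin (m + 1))).card := Finset.card_image_le
    _ = _ := by simp

/-- A polynomial factor cannot absorb the exponential growth of (x / y)^m when x > y. -/
lemma le_of_pow_le_poly_mul_pow {x y : ℝ} (hy : 0 ≤ y) (c : ℕ)
    (h : ∀ m : ℕ, x ^ m ≤ (m + 1) ^ c * y ^ m) : x ≤ y := by
  by_contra! hlt
  rcases hy.eq_or_lt with rfl | hy0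
  · have := h 1
    simp at this
    linarith
  have hr : 1 < x / y := (one_lt_div hy0).mpr hlt
  have hr0 : 0 < x / y := by linarith
  -- The shift matches the base m + 1 of the polynomial. It costs one extra factor x / y, which the
  -- threshold (x / y)⁻¹ repays.
  have hlim := (tendsto_add_atTop_iff_nat 1).mpr
    (tendsto_pow_const_div_const_pow_of_one_lt c hr)
  obtain ⟨m, hm⟩ := (hlim.eventually_lt_const (inv_pos.mpr hr0)).exists
  have h1 : (x / y) ^ m ≤ (m + 1) ^ c := by
    rw [div_pow, div_le_iff₀ (by positivity)]
    exact h m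
  rw [div_lt_iff₀ (by positivity), pow_succ, mul_comm ((x / y) ^ m), ← mul_assoc,
    inv_mul_cancel₀ hr0.ne', one_mul] at hm
  push_cast at hm
  linarith

/-- The **Araki–Lieb–Thirring inequality** for exponents in `(0, 1]`. -/
lemma trace_psdPow_mul_psdPow_le {A B : Matrix d d ℂ} (hA : A.PosSemidef) (hB : B.PosSemidef)
    {s : ℝ} (hs : 0 < s) (hs1 : s ≤ 1) :
    (psdPow A s * psdPow B (1 - s)).trace.re ≤ Qnew s A B := by
  have hY : (psdPow B ((1 - s) / (2 * s)) * A * psdPow B ((1 - s) / (2 * s))).PosSemidef := by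
    have := hA.conjTranspose_mul_mul_same (psdPow B ((1 - s) / (2 * s)))
    rwa [(posSemidef_psdPow hB.1 _).1.eq] at this
  -- Both sides are multiplicative under tensor powers, so the weaker inequality for A^{⊗m}, B^{⊗m}
  -- loses only (m + 1)^{dim}.
  refine le_of_pow_le_poly_mul_pow (trace_re_nonneg (posSemidef_psdPow hY.1 s))
    (Fintype.card d) fun m => ?_
  have hre : ∀ z : ℂ, 0 ≤ z → (z ^ m).re = z.re ^ m := by
    intro z hz
    have : z = (z.re : ℂ) := Complex.ext rfl (Complex.le_def.mp hz).2.symm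
    rw [this, ← Complex.ofReal_pow, Complex.ofReal_re, Complex.ofReal_re]
  have h1 : (psdPow (tensorPow m A) s * psdPow (tensorPow m B) (1 - s)).trace.re
      = (psdPow A s * psdPow B (1 - s)).trace.re ^ m := by
    rw [psdPow_tensorPow m hA, psdPow_tensorPow m hB, tensorPow_mul, trace_tensorPow, hre]
    exact trace_mul_nonneg_complex (posSemidef_psdPow hA.1 _) (posSemidef_psdPow hB.1 _)
  have h2 : (psdPow (psdPow (tensorPow m B) ((1 - s) / (2 * s)) * tensorPow m A *
      psdPow (tensorPow m B) ((1 - s) / (2 * s))) s).trace.re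
      = (psdPow (psdPow B ((1 - s) / (2 * s)) * A * psdPow B ((1 - s) / (2 * s))) s).trace.re
        ^ m := by
    rw [psdPow_tensorPow m hB, tensorPow_mul, tensorPow_mul, psdPow_tensorPow m hY,
      trace_tensorPow, hre]
    exact (posSemidef_psdPow hY.1 s).trace_nonneg
  rw [Qnew, ← h1, ← h2]
  obtain ⟨U, b, hU, hb, rfl⟩ := exists_udiag_of_posSemidef hB
  rw [tensorPow_udiag]
  refine (trace_psdPow_mul_udiag_le (posSemidef_tensorPow m hA) (tensorPow_unitary m hU) _
    hs hs1).trans ?_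
  refine mul_le_mul_of_nonneg_right (by exact_mod_cast card_image_prod_le m b) ?_
  rw [← tensorPow_udiag, h2]
  exact pow_nonneg (trace_re_nonneg (posSemidef_psdPow hY.1 s)) m

/-! ### Properties of Q_t and the one-shot error bound -/

lemma Qnew_tensorPow (n : ℕ) {ρ σ : Matrix d d ℂ} (hρ : ρ.PosSemidef) (hσ : σ.PosSemidef)
    (t : ℝ) : Qnew t (tensorPow n ρ) (tensorPow n σ) = Qnew t ρ σ ^ n := by
  have hY : (psdPow σ ((1 - t) / (2 * t)) * ρ * psdPow σ ((1 - t) / (2 * t))).PosSemidef := by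
    have := hρ.conjTranspose_mul_mul_same (psdPow σ ((1 - t) / (2 * t)))
    rwa [(posSemidef_psdPow hσ.1 _).1.eq] at this
  have h0 := (posSemidef_psdPow hY.1 t).trace_nonneg
  rw [Qnew, psdPow_tensorPow n hσ, tensorPow_mul, tensorPow_mul, psdPow_tensorPow n hY,
    trace_tensorPow, Qnew]
  have : (psdPow (psdPow σ ((1 - t) / (2 * t)) * ρ * psdPow σ ((1 - t) / (2 * t))) t).trace
      = ((psdPow (psdPow σ ((1 - t) / (2 * t)) * ρ * psdPow σ ((1 - t) / (2 * t))) t).trace.re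
        : ℂ) := Complex.ext rfl (Complex.le_def.mp h0).2.symm
  rw [this, ← Complex.ofReal_pow, Complex.ofReal_re, Complex.ofReal_re]

lemma psdPow_zero_mul_of_supp_le {ρ σ : Matrix d d ℂ} (hσ : σ.PosSemidef)
    (h : supp ρ ≤ supp σ) : psdPow σ 0 * ρ = ρ := by
  have h1 : psdPow σ 0 * σ = σ := by
    nth_rw 2 [← psdPow_one hσ]
    rw [psdPow_mul_psdPow hσ.1, zero_add, psdPow_one hσ]
  apply Matrix.ext_of_mulVec_single
  intro i
  obtain ⟨w, hw⟩ := h (LinearMap.mem_range_self ρ.mulVecLin (Pi.single i 1))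
  simp only [mulVecLin_apply] at hw
  rw [← mulVec_mulVec, ← hw, mulVec_mulVec, h1]

/-- By the support inclusion the projection σ^0 fixes ρ on both sides, so Q_1 is Tr ρ. -/
lemma Qnew_one {ρ σ : Matrix d d ℂ} (hρ : IsState ρ) (hσ : σ.PosSemidef)
    (h : supp ρ ≤ supp σ) : Qnew 1 ρ σ = 1 := by
  have h1 := psdPow_zero_mul_of_supp_le hσ h
  have h2 : ρ * psdPow σ 0 = ρ := by
    have := congrArg conjTranspose h1
    rwa [conjTranspose_mul, hρ.1.1.eq, (posSemidef_psdPow hσ.1 0).1.eq] at this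
  rw [Qnew, sub_self, zero_div, h1, h2, psdPow_one hρ.1, hρ.2, Complex.one_re]

lemma posSemidef_sandwich {ρ σ : Matrix d d ℂ} (hρ : ρ.PosSemidef) (hσ : σ.IsHermitian)
    (p : ℝ) : (psdPow σ p * ρ * psdPow σ p).PosSemidef := by
  have := hρ.conjTranspose_mul_mul_same (psdPow σ p)
  rwa [(posSemidef_psdPow hσ p).1.eq] at this

lemma Qnew_nonneg {ρ σ : Matrix d d ℂ} (hρ : ρ.PosSemidef) (hσ : σ.PosSemidef) (t : ℝ) :
    0 ≤ Qnew t ρ σ :=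
  trace_re_nonneg (posSemidef_psdPow (posSemidef_sandwich hρ hσ.1 _).1 t)

/-- Sandwiching by a power of σ is linear, so Rotfel'd's inequality passes to Q_t. -/
lemma Qnew_smul_sum_le {ι : Type*} (S : Finset ι) {X : ι → Matrix d d ℂ} {σ : Matrix d d ℂ}
    (hX : ∀ i ∈ S, (X i).PosSemidef) (hσ : σ.PosSemidef) {c t : ℝ} (hc : 0 < c) (ht : 0 < t)
    (ht1 : t ≤ 1) : Qnew t ((c : ℂ) • ∑ i ∈ S, X i) σ ≤ c ^ t * ∑ i ∈ S, Qnew t (X i) σ := by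
  set s := psdPow σ ((1 - t) / (2 * t)) with hs
  have hsX : ∀ i ∈ S, (s * X i * s).PosSemidef := fun i hi =>
    posSemidef_sandwich (hX i hi) hσ.1 _
  have h : s * ((c : ℂ) • ∑ i ∈ S, X i) * s = (c : ℂ) • ∑ i ∈ S, s * X i * s := by
    rw [Matrix.mul_smul, Matrix.smul_mul, Finset.mul_sum, Finset.sum_mul]
  rw [Qnew, h, psdPow_smul (posSemidef_sum S hsX).1 hc, trace_smul, smul_eq_mul,
    Complex.re_ofReal_mul]
  exact mul_le_mul_of_nonneg_left (trace_psdPow_sum_le S _ hsX ht ht1) (by positivity)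

/-- The non-asymptotic error bound for the composite Neyman–Pearson test. -/
lemma npTest_error_le {σ : Matrix d d ℂ} (hσ : σ.PosSemidef) (F : Finset (Matrix d d ℂ))
    (hF : ∀ ρ ∈ F, IsState ρ) (hsupp : ∀ ρ ∈ F, supp ρ ≤ supp σ) (n : ℕ) (a : ℝ) {t : ℝ}
    (ht : 0 < t) (ht1 : t ≤ 1) :
    Real.exp (-(n * a)) * ((∑ ρ ∈ F, tensorPow n ρ) * (1 - npTest σ F n a)).trace.re
        + (tensorPow n σ * npTest σ F n a).trace.re
      ≤ Real.exp (-(n * (a * t))) * ∑ ρ ∈ F, Qnew t ρ σ ^ n := by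
  set c := Real.exp (-(n * a)) with hc
  have hc0 : 0 < c := Real.exp_pos _
  have hct : Real.exp (-(n * (a * t))) = c ^ t := by
    rw [hc, ← Real.exp_mul]
    congr 1
    ring
  have hX : ∀ ρ ∈ F, (tensorPow n ρ).PosSemidef := fun ρ hρ => posSemidef_tensorPow n (hF ρ hρ).1
  have hS := posSemidef_sum F hX
  have hA : ((c : ℂ) • ∑ ρ ∈ F, tensorPow n ρ).PosSemidef :=
    hS.smul (Complex.zero_le_real.mpr hc0.le)
  have hB := posSemidef_tensorPow n hσ
  have hL : c * ((∑ ρ ∈ F, tensorPow n ρ) * (1 - npTest σ F n a)).trace.re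
      = (((c : ℂ) • ∑ ρ ∈ F, tensorPow n ρ) * (1 - npTest σ F n a)).trace.re := by
    rw [Matrix.smul_mul, trace_smul, smul_eq_mul, Complex.re_ofReal_mul]
  rw [hL, hct]
  rcases ht1.lt_or_eq with h | rfl
  · refine (trace_error_le_trace_psdPow_mul hA hB ht h).trans ?_
    refine (trace_psdPow_mul_psdPow_le hA hB ht ht1).trans ?_
    refine (Qnew_smul_sum_le F hX hB hc0 ht ht1).trans (le_of_eq ?_)
    congr 1
    exact Finset.sum_congr rfl fun ρ hρ => Qnew_tensorPow n (hF ρ hρ).1 hσ t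
  -- At t = 1 the right side is Tr A, and the claim is just Tr (A - B)₊ ≥ 0.
  · have h1 : ∑ ρ ∈ F, Qnew 1 ρ σ ^ n = (∑ ρ ∈ F, tensorPow n ρ).trace.re := by
      rw [trace_sum, Complex.re_sum]
      refine Finset.sum_congr rfl fun ρ hρ => ?_
      rw [Qnew_one (hF ρ hρ) hσ (hsupp ρ hρ), trace_tensorPow, (hF ρ hρ).2]
      simp
    have h2 := trace_re_nonneg
      (posSemidef_mul_posProj (((c : ℂ) • ∑ ρ ∈ F, tensorPow n ρ) - tensorPow n σ)
        (hA.1.sub hB.1)).1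
    change 0 ≤ (_ * npTest σ F n a).trace.re at h2
    have h3 : c * (∑ ρ ∈ F, tensorPow n ρ).trace.re
        = ((c : ℂ) • ∑ ρ ∈ F, tensorPow n ρ).trace.re := by
      rw [trace_smul, smul_eq_mul, Complex.re_ofReal_mul]
    rw [Real.rpow_one, h1, h3]
    simp only [Matrix.sub_mul, Matrix.mul_sub, Matrix.mul_one, trace_sub, Complex.sub_re] at h2 ⊢
    linarith

/-! ### Replacing a state by a nearby one -/

/-- A self-adjoint matrix is dominated by a positive one of trace at most its trace norm. -/
lemma exists_posSemidef_dominating {X : Matrix d d ℂ} (hX : X.IsHermitian) :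
    ∃ Δ : Matrix d d ℂ, Δ.PosSemidef ∧ (Δ - X).PosSemidef ∧ Δ.trace.re ≤ traceNorm X := by
  obtain ⟨U, D, hU, rfl⟩ := exists_udiag hX
  refine ⟨udiag U fun i => |D i|, posSemidef_udiag U fun i => abs_nonneg _, ?_, le_of_eq ?_⟩
  · rw [udiag_sub]
    exact posSemidef_udiag U fun i => sub_nonneg.mpr (le_abs_self _)
  · rw [traceNorm, hX.eq, udiag_mul hU, psdPow_udiag hU, trace_udiag hU, trace_udiag hU]
    congr 2
    refine Finset.sum_congr rfl fun i _ => ?_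
    split_ifs with h
    · rw [← Real.sqrt_eq_rpow, Real.sqrt_mul_self_eq_abs]
    · have : D i = 0 := by
        by_contra h0
        exact h (mul_self_pos.mpr h0)
      simp [this]

lemma piTensor_update {n : ℕ} (M : Fin n → Matrix d d ℂ) (k : Fin n) (X : Matrix d d ℂ)
    (f g : Fin n → d) : piTensor (Function.update M k X) f g
      = X (f k) (g k) * ∏ i ∈ Finset.univ.erase k, M i (f i) (g i) := by
  simp only [piTensor, of_apply]
  rw [← Finset.mul_prod_erase _ _ (Finset.mem_univ k)]
  congr 1
  · simp
  · refine Finset.prod_congr rfl fun i hi => ?_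
    rw [Function.update_of_ne (Finset.ne_of_mem_erase hi)]

lemma piTensor_update_add {n : ℕ} (M : Fin n → Matrix d d ℂ) (k : Fin n)
    (X Y : Matrix d d ℂ) : piTensor (Function.update M k (X + Y))
      = piTensor (Function.update M k X) + piTensor (Function.update M k Y) := by
  ext f g
  simp only [Matrix.add_apply, piTensor_update, add_mul]

/-- Hybrid argument: ρ' is replaced by ρ in one factor at a time. Since ρ ≤ ρ' + Δ and 0 ≤ T ≤ 1,
each replacement costs at most Tr Δ ≤ ‖ρ - ρ'‖₁, the other factors having trace one. -/
lemma trace_tensorPow_mul_le {ρ ρ' : Matrix d d ℂ} (hρ : IsState ρ) (hρ' : IsState ρ') (n : ℕ)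
    {T : Matrix (Fin n → d) (Fin n → d) ℂ} (hT : T.PosSemidef) (hT1 : (1 - T).PosSemidef) :
    (tensorPow n ρ * T).trace.re
      ≤ (tensorPow n ρ' * T).trace.re + n * traceNorm (ρ - ρ') := by
  obtain ⟨Δ, hΔ, hΔX, hΔt⟩ := exists_posSemidef_dominating (hρ.1.1.sub hρ'.1.1)
  have key : ∀ S : Finset (Fin n), (piTensor (fun i => if i ∈ S then ρ else ρ') * T).trace.re
      ≤ (tensorPow n ρ' * T).trace.re + S.card * traceNorm (ρ - ρ') := by
    intro S
    induction S using Finset.induction_on with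
    | empty => simp [tensorPow_eq_piTensor]
    | insert k S hk ih =>
      set M : Fin n → Matrix d d ℂ := fun i => if i ∈ S then ρ else ρ' with hM
      have hMs : ∀ i, IsState (M i) := by
        intro i
        simp only [hM]
        split_ifs <;> assumption
      have e1 : (fun i => if i ∈ insert k S then ρ else ρ') = Function.update M k ρ := by
        ext1 i
        by_cases h : i = k
        · subst h; simp
        · simp [h, hM]
      have e2 : M = Function.update M k ρ' := by
        conv_lhs => rw [← Function.update_eq_self k M]
        simp [hM, hk]
      have hpsd : ∀ X : Matrix d d ℂ, X.PosSemidef →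
          (piTensor (Function.update M k X)).PosSemidef := by
        intro X hX
        refine posSemidef_piTensor fun i => ?_
        by_cases h : i = k
        · subst h; simpa using hX
        · simpa [h] using (hMs i).1
      -- Linearity in slot k applied to ρ + (Δ - (ρ - ρ')) = ρ' + Δ, which keeps every tensor
      -- product except M's neighbours in the positive cone.
      have hadd : piTensor (Function.update M k ρ)
            + piTensor (Function.update M k (Δ - (ρ - ρ')))
          = piTensor M + piTensor (Function.update M k Δ) := by
        conv_rhs => rw [e2]
        simp only [Function.update_idem]
        rw [← piTensor_update_add, ← piTensor_update_add]
        congr 2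
        abel
      have htr : (piTensor (Function.update M k Δ)).trace = Δ.trace := by
        rw [trace_piTensor, ← Finset.mul_prod_erase _ _ (Finset.mem_univ k),
          Function.update_self, Finset.prod_eq_one, mul_one]
        intro i hi
        rw [Function.update_of_ne (Finset.ne_of_mem_erase hi), (hMs i).2]
      have h1 := congrArg (fun Z => (Z * T).trace.re) hadd
      simp only [Matrix.add_mul, trace_add, Complex.add_re] at h1
      have h2 := trace_mul_nonneg (hpsd _ hΔX) hT
      have h3 := trace_mul_nonneg (hpsd _ hΔ) hT1
      rw [Matrix.mul_sub, Matrix.mul_one, trace_sub, htr, Complex.sub_re] at h3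
      rw [e1, Finset.card_insert_of_notMem hk]
      push_cast
      linarith
  simpa [tensorPow_eq_piTensor] using key Finset.univ

/-! ### Optimisation over t in the extended reals -/

lemma ofReal_Qnew_le_exp_psi {𝒩 : Set (Matrix d d ℂ)} {ρ : Matrix d d ℂ} (hρ : ρ ∈ 𝒩)
    (σ : Matrix d d ℂ) (t : ℝ) : ENNReal.ofReal (Qnew t ρ σ) ≤ EReal.exp (psi 𝒩 σ t) := by
  rw [← ENNReal.exp_log (ENNReal.ofReal (Qnew t ρ σ))]
  exact EReal.exp_monotone
    (le_iSup₂ (f := fun ρ (_ : ρ ∈ 𝒩) => ENNReal.log (ENNReal.ofReal (Qnew t ρ σ))) ρ hρ)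

/-- The case x = -∞ reads 0 = c · 0^n, which is where n ≥ 1 matters. -/
lemma exp_neg_natCast_mul_sub {n : ℕ} (hn : 1 ≤ n) (b : ℝ) (x : EReal) :
    EReal.exp (-((n : EReal) * ((b : EReal) - x)))
      = ENNReal.ofReal (Real.exp (-(n * b))) * EReal.exp x ^ n := by
  have hn0 : (0 : EReal) < n := by exact_mod_cast hn
  have h : -((n : EReal) * ((b : EReal) - x)) = ((-(n * b) : ℝ) : EReal) + n * x := by
    induction x with
    | bot => simp [EReal.mul_bot_of_pos hn0, EReal.mul_top_of_pos hn0]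
    | top =>
      rw [EReal.sub_top, EReal.mul_bot_of_pos hn0, EReal.mul_top_of_pos hn0, EReal.neg_bot,
        EReal.coe_add_top]
    | coe x =>
      rw [← EReal.coe_natCast, ← EReal.coe_sub, ← EReal.coe_mul, ← EReal.coe_mul,
        ← EReal.coe_neg, ← EReal.coe_add]
      congr 1
      ring
  rw [h, EReal.exp_add, EReal.exp_coe, EReal.exp_nmul]

lemma ofReal_le_card_mul_exp {𝒩 : Set (Matrix d d ℂ)} {σ : Matrix d d ℂ} (hσ : σ.PosSemidef)
    {F : Finset (Matrix d d ℂ)} (hF : (F : Set (Matrix d d ℂ)) ⊆ 𝒩)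
    (hstate : ∀ ρ ∈ 𝒩, IsState ρ) {n : ℕ} (hn : 1 ≤ n) {b t x : ℝ}
    (h : x ≤ Real.exp (-(n * b)) * ∑ ρ ∈ F, Qnew t ρ σ ^ n) :
    ENNReal.ofReal x
      ≤ (F.card : ℝ≥0∞) * EReal.exp (-((n : EReal) * ((b : EReal) - psi 𝒩 σ t))) := by
  refine (ENNReal.ofReal_le_ofReal h).trans ?_
  have hQ : ∀ ρ ∈ F, 0 ≤ Qnew t ρ σ := fun ρ hρ => Qnew_nonneg (hstate ρ (hF hρ)).1 hσ t
  rw [exp_neg_natCast_mul_sub hn, ENNReal.ofReal_mul (Real.exp_pos _).le,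
    ENNReal.ofReal_sum_of_nonneg fun ρ hρ => pow_nonneg (hQ ρ hρ) n, mul_left_comm]
  gcongr
  rw [← nsmul_eq_mul]
  refine Finset.sum_le_card_nsmul _ _ _ fun ρ hρ => ?_
  rw [ENNReal.ofReal_pow (hQ ρ hρ)]
  gcongr
  exact ofReal_Qnew_le_exp_psi (hF hρ) σ t

/-- The supremum need not be attained, so the bound is solved for the exponent: it says y ≤ -log(x /
N) / n, a condition that passes to suprema. When N = 0, one t ∈ I is needed to conclude x = 0. -/
lemma le_natCast_mul_exp_iSup {x : ℝ≥0∞} {N n : ℕ} (hn : 1 ≤ n) {I : Set ℝ} (hI : I.Nonempty)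
    {f : ℝ → EReal}
    (h : ∀ t ∈ I, x ≤ (N : ℝ≥0∞) * EReal.exp (-((n : EReal) * f t))) :
    x ≤ (N : ℝ≥0∞) * EReal.exp (-((n : EReal) * ⨆ t ∈ I, f t)) := by
  rcases Nat.eq_zero_or_pos N with rfl | hN
  · obtain ⟨t, ht⟩ := hI
    simpa using h t ht
  have hN0 : (N : ℝ≥0∞) ≠ 0 := by exact_mod_cast hN.ne'
  have hNt : (N : ℝ≥0∞) ≠ ⊤ := ENNReal.natCast_ne_top N
  have hn0 : (0 : EReal) < n := by exact_mod_cast hn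
  have hnt : (n : EReal) ≠ ⊤ := EReal.natCast_ne_top n
  have key : ∀ y : EReal, x ≤ (N : ℝ≥0∞) * EReal.exp (-((n : EReal) * y))
      ↔ y ≤ -ENNReal.log (x / N) / n := by
    intro y
    rw [← ENNReal.div_le_iff' hN0 hNt, ← ENNReal.log_le_log_iff, EReal.log_exp,
      EReal.le_neg, EReal.le_div_iff_mul_le hn0 hnt, mul_comm]
  rw [key]
  exact iSup₂_le fun t ht => (key _).mp (h t ht)

lemma typeII_npTest_le {𝒩 : Set (Matrix d d ℂ)} (hstate : ∀ ρ ∈ 𝒩, IsState ρ)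
    {σ : Matrix d d ℂ} (hσ : σ.PosSemidef) (hsupp : ∀ ρ ∈ 𝒩, supp ρ ≤ supp σ) {n : ℕ}
    (hn : 1 ≤ n) {F : Finset (Matrix d d ℂ)} (hF : (F : Set (Matrix d d ℂ)) ⊆ 𝒩) (a : ℝ) :
    typeII σ n (npTest σ F n a)
      ≤ (F.card : ℝ≥0∞) * EReal.exp (-((n : EReal) * phi 𝒩 σ a)) := by
  refine le_natCast_mul_exp_iSup hn ⟨1, by simp⟩ fun t ht => ?_
  refine ofReal_le_card_mul_exp hσ hF hstate hn ?_
  have h := npTest_error_le hσ F (fun ρ hρ => hstate ρ (hF hρ)) (fun ρ hρ => hsupp ρ (hF hρ))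
    n a ht.1 ht.2
  have hS : (∑ ρ ∈ F, tensorPow n ρ).PosSemidef :=
    posSemidef_sum F fun ρ hρ => posSemidef_tensorPow n (hstate ρ (hF hρ)).1
  have hX : (((Real.exp (-(n * a)) : ℝ) : ℂ) • (∑ ρ ∈ F, tensorPow n ρ)
      - tensorPow n σ).IsHermitian :=
    (hS.smul (Complex.zero_le_real.mpr (Real.exp_pos _).le)).1.sub (posSemidef_tensorPow n hσ).1
  have h0 := mul_nonneg (Real.exp_pos (-(n * a))).le
    (trace_mul_nonneg hS (posSemidef_one_sub_posProj _ hX))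
  change 0 ≤ _ * (_ * (1 - npTest σ F n a)).trace.re at h0
  linarith

lemma typeI_npTest_le {𝒩 : Set (Matrix d d ℂ)} (h𝒩 : 𝒩.Nonempty)
    (hstate : ∀ ρ ∈ 𝒩, IsState ρ) {σ : Matrix d d ℂ} (hσ : σ.PosSemidef)
    (hsupp : ∀ ρ ∈ 𝒩, supp ρ ≤ supp σ) {n : ℕ} (hn : 1 ≤ n) {F : Finset (Matrix d d ℂ)}
    (hF : (F : Set (Matrix d d ℂ)) ⊆ 𝒩) (a : ℝ) :
    typeI 𝒩 n (npTest σ F n a)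
      ≤ (F.card : ℝ≥0∞) * EReal.exp (-((n : EReal) * phiHat 𝒩 σ a))
        + (n : ℝ≥0∞) * netRadius 𝒩 F := by
  have hn0 : (n : ℝ≥0∞) ≠ 0 := by exact_mod_cast (by omega : n ≠ 0)
  -- An empty net has infinite radius because 𝒩 is non-empty, and n ≥ 1 keeps the product n · ∞
  -- infinite.
  rcases F.eq_empty_or_nonempty with rfl | hne
  · have : netRadius 𝒩 ∅ = ⊤ := by
      obtain ⟨ρ, hρ⟩ := h𝒩
      refine top_unique (le_iSup₂_of_le ρ hρ ?_)
      simp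
    rw [this, ENNReal.mul_top hn0, add_top]
    exact le_top
  have hS : (∑ ρ ∈ F, tensorPow n ρ).PosSemidef :=
    posSemidef_sum F fun ρ hρ => posSemidef_tensorPow n (hstate ρ (hF hρ)).1
  have hX : (((Real.exp (-(n * a)) : ℝ) : ℂ) • (∑ ρ ∈ F, tensorPow n ρ)
      - tensorPow n σ).IsHermitian :=
    (hS.smul (Complex.zero_le_real.mpr (Real.exp_pos _).le)).1.sub (posSemidef_tensorPow n hσ).1
  have hP : (npTest σ F n a).PosSemidef := posSemidef_posProj _ hX
  have hT : (1 - npTest σ F n a).PosSemidef := posSemidef_one_sub_posProj _ hX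
  have hsum : ENNReal.ofReal ((∑ ρ ∈ F, tensorPow n ρ) * (1 - npTest σ F n a)).trace.re
      ≤ (F.card : ℝ≥0∞) * EReal.exp (-((n : EReal) * phiHat 𝒩 σ a)) := by
    refine le_natCast_mul_exp_iSup hn ⟨1, by simp⟩ fun t ht => ?_
    refine ofReal_le_card_mul_exp hσ hF hstate hn ?_
    have h := npTest_error_le hσ F (fun ρ hρ => hstate ρ (hF hρ))
      (fun ρ hρ => hsupp ρ (hF hρ)) n a ht.1 ht.2
    have h0 := trace_mul_nonneg (posSemidef_tensorPow n hσ) hP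
    -- Cancelling the weight e^{-na} of the type I term turns at into a(t - 1), that is, φ into φ̂.
    have he : Real.exp (-(n * (a * t)))
        = Real.exp (-(n * a)) * Real.exp (-(n * (a * (t - 1)))) := by
      rw [← Real.exp_add]
      congr 1
      ring
    rw [he, mul_assoc] at h
    exact le_of_mul_le_mul_left ((le_add_of_nonneg_right h0).trans h) (Real.exp_pos _)
  refine iSup₂_le fun ρ hρ => ?_
  -- The nearest net point exists because F is finite and non-empty. Its error is one non-negative
  -- term of the sum bounded in `hsum`.
  obtain ⟨ρ', hρ', hmin⟩ := F.exists_min_image (fun ρ' => traceNorm (ρ - ρ')) hne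
  have h1 := trace_tensorPow_mul_le (hstate ρ hρ) (hstate ρ' (hF hρ')) n hT
    (by simpa using hP)
  have h2 : (tensorPow n ρ' * (1 - npTest σ F n a)).trace.re
      ≤ ((∑ ρ ∈ F, tensorPow n ρ) * (1 - npTest σ F n a)).trace.re := by
    rw [Finset.sum_mul, trace_sum, Complex.re_sum]
    exact Finset.single_le_sum (f := fun ρ => (tensorPow n ρ * (1 - npTest σ F n a)).trace.re)
      (fun ρ hρ => trace_mul_nonneg (posSemidef_tensorPow n (hstate ρ (hF hρ)).1) hT) hρ'
  refine (ENNReal.ofReal_le_ofReal (h1.trans (add_le_add_left h2 _))).trans ?_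
  refine ENNReal.ofReal_add_le.trans (add_le_add hsum ?_)
  rw [ENNReal.ofReal_mul (Nat.cast_nonneg n), ENNReal.ofReal_natCast]
  gcongr
  refine le_iSup₂_of_le ρ hρ (le_iInf₂ fun ρ'' hρ'' => ?_)
  exact ENNReal.ofReal_le_ofReal (hmin ρ'' hρ'')

/-! ### Exponential rates -/

/-- The prefactor C n disappears under (1/n) log. The factor n is allowed because the net radius
enters multiplied by n. -/
lemma expRate_le {e : ℕ → ℝ≥0∞} {C x : ℝ} (hC : 0 < C)
    (h : ∀ n : ℕ, 1 ≤ n → e n ≤ ENNReal.ofReal (C * n * Real.exp (-(n * x)))) :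
    expRate e ≤ ((-x : ℝ) : EReal) := by
  have hlim : Tendsto (fun n : ℕ => Real.log C / n + Real.log n / n - x) atTop
      (nhds (-x)) := by
    have h1 : Tendsto (fun n : ℕ => Real.log C / (n : ℝ)) atTop (nhds 0) :=
      tendsto_const_div_atTop_nhds_zero_nat _
    have h2 : Tendsto (fun n : ℕ => Real.log n / (n : ℝ)) atTop (nhds 0) := by
      have := (Real.tendsto_pow_log_div_mul_add_atTop 1 0 1 one_ne_zero).comp
        (tendsto_natCast_atTop_atTop (R := ℝ))
      simpa [Function.comp_def] using this
    simpa using (h1.add h2).sub_const x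
  rw [← (EReal.tendsto_coe.mpr hlim).limsup_eq]
  refine limsup_le_limsup ?_
  filter_upwards [eventually_ge_atTop 1] with n hn
  have hn0 : (0 : ℝ) < n := by exact_mod_cast hn
  have h1 : ENNReal.log (e n) ≤ ((Real.log C + Real.log n - n * x : ℝ) : EReal) := by
    refine (ENNReal.log_monotone (h n hn)).trans (le_of_eq ?_)
    rw [ENNReal.log_ofReal_of_pos (by positivity), Real.log_mul (by positivity) (by positivity),
      Real.log_mul hC.ne' hn0.ne', Real.log_exp]
    congr 1
  refine (mul_le_mul_of_nonneg_left h1 (by exact_mod_cast by positivity)).trans (le_of_eq ?_)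
  rw [← EReal.coe_mul]
  congr 1
  field_simp

lemma expRate_eq_bot {e : ℕ → ℝ≥0∞} (h : ∀ n : ℕ, 1 ≤ n → e n = 0) : expRate e = ⊥ := by
  have : (fun n : ℕ => ((1 / (n : ℝ) : ℝ) : EReal) * ENNReal.log (e n)) =ᶠ[atTop]
      fun _ => ⊥ := by
    filter_upwards [eventually_ge_atTop 1] with n hn
    have hn0 : (0 : ℝ) < 1 / n := by positivity
    rw [h n hn, ENNReal.log_zero, EReal.coe_mul_bot_of_pos hn0]
  rw [expRate, limsup_congr this]
  simp

lemma natCast_mul_exp_le {N n D : ℕ} {κ : ℝ} (hκ : 0 < κ)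
    (hN : (N : ℝ) ≤ (1 + 2 / Real.exp (-(n * κ))) ^ D) (y : ℝ) :
    (N : ℝ≥0∞) * EReal.exp (-((n : EReal) * (y : EReal)))
      ≤ ENNReal.ofReal (3 ^ D * Real.exp (-(n * (y - κ * D)))) := by
  rw [← EReal.coe_natCast, ← EReal.coe_mul, ← EReal.coe_neg, EReal.exp_coe,
    ← ENNReal.ofReal_natCast, ← ENNReal.ofReal_mul (Nat.cast_nonneg N)]
  refine ENNReal.ofReal_le_ofReal ?_
  -- The constant 3 comes from 1 ≤ e^{nκ}.
  have h1 : 1 + 2 / Real.exp (-(n * κ)) ≤ 3 * Real.exp (n * κ) := by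
    have : 1 ≤ Real.exp (n * κ) := Real.one_le_exp (by positivity)
    rw [Real.exp_neg, div_inv_eq_mul]
    linarith
  have h2 : (N : ℝ) ≤ 3 ^ D * Real.exp (n * κ * D) := by
    refine hN.trans ((pow_le_pow_left₀ (by positivity) h1 D).trans (le_of_eq ?_))
    rw [mul_pow, ← Real.exp_nat_mul]
    congr 2
    ring
  refine (mul_le_mul_of_nonneg_right h2 (Real.exp_pos _).le).trans (le_of_eq ?_)
  rw [mul_assoc, ← Real.exp_add]
  congr 2
  ring

lemma netRadius_le {𝒩 : Set (Matrix d d ℂ)} {F : Finset (Matrix d d ℂ)} {r : ℝ}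
    (h : ∀ ρ ∈ 𝒩, ∃ ρ' ∈ F, traceNorm (ρ - ρ') < r) : netRadius 𝒩 F ≤ ENNReal.ofReal r := by
  refine iSup₂_le fun ρ hρ => ?_
  obtain ⟨ρ', hρ', hlt⟩ := h ρ hρ
  exact iInf₂_le_of_le ρ' hρ' (ENNReal.ofReal_le_ofReal hlt.le)

/-- The rate of a sequence bounded by `N_n e^{-n y}` with `N_n ≤ (1 + 2 e^{n κ}) ^ D`. -/
lemma expRate_le_of_card {e : ℕ → ℝ≥0∞} {N : ℕ → ℕ} {D : ℕ} {κ : ℝ} (hκ : 0 < κ) {y : EReal}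
    (hN : ∀ n : ℕ, 1 ≤ n → (N n : ℝ) ≤ (1 + 2 / Real.exp (-(n * κ))) ^ D)
    (he : ∀ n : ℕ, 1 ≤ n → e n ≤ (N n : ℝ≥0∞) * EReal.exp (-((n : EReal) * y))) :
    expRate e ≤ -(y - ((κ * D : ℝ) : EReal)) := by
  induction y with
  | bot => simp
  -- An infinite exponent forces e n = 0 for all n ≥ 1, hence rate -∞.
  | top =>
    rw [expRate_eq_bot]
    · simp
    · intro n hn
      have hn0 : (0 : EReal) < n := by exact_mod_cast hn
      simpa [EReal.mul_top_of_pos hn0] using he n hn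
  | coe y =>
    rw [← EReal.coe_sub, ← EReal.coe_neg]
    refine expRate_le (C := 3 ^ D) (by positivity) fun n hn => ?_
    refine (he n hn).trans ((natCast_mul_exp_le hκ (hN n hn) y).trans ?_)
    refine ENNReal.ofReal_le_ofReal ?_
    have hn1 : (1 : ℝ) ≤ n := by exact_mod_cast hn
    exact mul_le_mul_of_nonneg_right (le_mul_of_one_le_right (by positivity) hn1)
      (Real.exp_pos _).le

/-- The rate of a sequence bounded by `N_n e^{-n y} + n e^{-n κ}`. -/
lemma expRate_le_of_card_add {e : ℕ → ℝ≥0∞} {N : ℕ → ℕ} {D : ℕ} {κ : ℝ} (hκ : 0 < κ)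
    {y : EReal} (hN : ∀ n : ℕ, 1 ≤ n → (N n : ℝ) ≤ (1 + 2 / Real.exp (-(n * κ))) ^ D)
    (he : ∀ n : ℕ, 1 ≤ n → e n ≤ (N n : ℝ≥0∞) * EReal.exp (-((n : EReal) * y))
      + (n : ℝ≥0∞) * ENNReal.ofReal (Real.exp (-(n * κ)))) :
    expRate e ≤ -(min (κ : EReal) (y - ((κ * D : ℝ) : EReal))) := by
  have hr : ∀ n : ℕ, (n : ℝ≥0∞) * ENNReal.ofReal (Real.exp (-(n * κ)))
      = ENNReal.ofReal (n * Real.exp (-(n * κ))) := by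
    intro n
    rw [ENNReal.ofReal_mul (Nat.cast_nonneg n), ENNReal.ofReal_natCast]
  induction y with
  | bot => simp
  -- Only the net term n e^{-nκ} survives, so the rate is at most -κ.
  | top =>
    rw [EReal.top_sub_coe, min_top_right, ← EReal.coe_neg]
    refine expRate_le one_pos fun n hn => ?_
    have hn0 : (0 : EReal) < n := by exact_mod_cast hn
    have := he n hn
    rw [hr] at this
    simpa [EReal.mul_top_of_pos hn0] using this
  | coe y =>
    rw [← EReal.coe_sub, ← EReal.coe_strictMono.monotone.map_min, ← EReal.coe_neg]
    refine expRate_le (C := 3 ^ D + 1) (by positivity) fun n hn => ?_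
    have hn1 : (1 : ℝ) ≤ n := by exact_mod_cast hn
    refine (he n hn).trans ((add_le_add (natCast_mul_exp_le hκ (hN n hn) y) (hr n).le).trans ?_)
    rw [← ENNReal.ofReal_add (by positivity) (by positivity)]
    refine ENNReal.ofReal_le_ofReal ?_
    have h1 : Real.exp (-(n * (y - κ * D))) ≤ Real.exp (-(n * min κ (y - κ * D))) :=
      Real.exp_le_exp.mpr (neg_le_neg (mul_le_mul_of_nonneg_left (min_le_right _ _)
        (Nat.cast_nonneg n)))
    have h2 : Real.exp (-(n * κ)) ≤ Real.exp (-(n * min κ (y - κ * D))) :=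
      Real.exp_le_exp.mpr (neg_le_neg (mul_le_mul_of_nonneg_left (min_le_left _ _)
        (Nat.cast_nonneg n)))
    rw [add_mul, add_mul, one_mul]
    refine add_le_add ?_ (mul_le_mul_of_nonneg_left h2 (Nat.cast_nonneg n))
    exact mul_le_mul (le_mul_of_one_le_right (by positivity) hn1) h1 (Real.exp_pos _).le
      (by positivity)

end CompositeStein

theorem mainTheorem6 {d : Type*} [Fintype d] [DecidableEq d]
    (𝒩 : Set (Matrix d d ℂ)) (h𝒩 : 𝒩.Nonempty)
    (hstate : ∀ ρ ∈ 𝒩, CompositeStein.IsState ρ)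
    (σ : Matrix d d ℂ) (hσ : σ.PosSemidef)
    (hsupp : ∀ ρ ∈ 𝒩, CompositeStein.supp ρ ≤ CompositeStein.supp σ) :
    -- the bounds at every finite `n`, for every finite subset `F = 𝒩(n)` of `𝒩`
    (∀ (n : ℕ), 1 ≤ n → ∀ (F : Finset (Matrix d d ℂ)), (F : Set (Matrix d d ℂ)) ⊆ 𝒩 →
      ∀ a : ℝ,
        CompositeStein.typeI 𝒩 n (CompositeStein.npTest σ F n a)
            ≤ (F.card : ENNReal) * EReal.exp (-((n : EReal) * CompositeStein.phiHat 𝒩 σ a))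
              + (n : ENNReal) * CompositeStein.netRadius 𝒩 F ∧
        CompositeStein.typeII σ n (CompositeStein.npTest σ F n a)
            ≤ (F.card : ENNReal) * EReal.exp (-((n : EReal) * CompositeStein.phi 𝒩 σ a))) ∧
    -- the asymptotic rates for `e^{-nκ}`-nets `𝒩(n)` of cardinality at most
    -- `(1 + 2 / e^{-nκ})^D`, where `D` is the real dimension of a space `V` that contains `𝒩`
    (∀ (V : Submodule ℝ (Matrix d d ℂ)), 𝒩 ⊆ (V : Set (Matrix d d ℂ)) →
      ∀ κ : ℝ, 0 < κ → ∀ (Nn : ℕ → Finset (Matrix d d ℂ)),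
        (∀ n : ℕ, 1 ≤ n →
          (Nn n : Set (Matrix d d ℂ)) ⊆ 𝒩 ∧
          ((Nn n).card : ℝ) ≤ (1 + 2 / Real.exp (-(n * κ))) ^ Module.finrank ℝ V ∧
          ∀ ρ ∈ 𝒩, ∃ ρ' ∈ Nn n, CompositeStein.traceNorm (ρ - ρ') < Real.exp (-(n * κ))) →
        ∀ a : ℝ,
          CompositeStein.expRate
              (fun n => CompositeStein.typeI 𝒩 n (CompositeStein.npTest σ (Nn n) n a))
            ≤ -(min (κ : EReal)
                (CompositeStein.phiHat 𝒩 σ a - ((κ * Module.finrank ℝ V : ℝ) : EReal))) ∧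
          CompositeStein.expRate
              (fun n => CompositeStein.typeII σ n (CompositeStein.npTest σ (Nn n) n a))
            ≤ -(CompositeStein.phi 𝒩 σ a - ((κ * Module.finrank ℝ V : ℝ) : EReal))) := by
  refine ⟨fun n hn F hF a => ⟨?_, ?_⟩, fun V _ κ hκ Nn hNn a => ⟨?_, ?_⟩⟩
  · exact CompositeStein.typeI_npTest_le h𝒩 hstate hσ hsupp hn hF a
  · exact CompositeStein.typeII_npTest_le hstate hσ hsupp hn hF a
  · refine CompositeStein.expRate_le_of_card_add hκ (fun n hn => (hNn n hn).2.1) fun n hn => ?_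
    refine (CompositeStein.typeI_npTest_le h𝒩 hstate hσ hsupp hn (hNn n hn).1 a).trans ?_
    gcongr
    exact CompositeStein.netRadius_le (hNn n hn).2.2
  · exact CompositeStein.expRate_le_of_card hκ (fun n hn => (hNn n hn).2.1) fun n hn =>
      CompositeStein.typeII_npTest_le hstate hσ hsupp hn (hNn n hn).1 a
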